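/- Let $S$ and $A$ be finite sets of states and actions. Consider a communicating Markov decision process on them (for any two states $i,j$ some deterministic stationary policy makes $j$ accessible from $i$) with transition probabilities $p(j\mid i,a)$, rewards $c(i,a,j)$ with $|c(i,a,j)|\le C_{\max}$, and discount factor $\beta\in[0,1)$. Let $N>0$, and define the smooth Bellman operator on $\mathbb{R}^{S\times A}$ by $$(UQ)(i,a)=\sum_{j\in S}p(j\mid i,a)\,c(i,a,j)+\beta\sum_{j\in S}p(j\mid i,a)\,\frac1N\log\sum_{b\in A}e^{NQ(j,b)} .$$ At iteration $n=0,1,2,\dots$ a sample $(s_n,a_n,s'_n,a'_n,s''_n)$ is drawn, where the actions $a_n$ and $a'_n$ are chosen by a behaviour policy that may be randomised and may depend on the past but not on the future, $s'_n$ has law $p(\cdot\mid s_n,a_n)$ given the past up to and including $a_n$, and $s''_n$ has law $p(\cdot\mid s'_n,a'_n)$ given the past up to and including $a'_n$ (in particular, single trajectories with $s_{n+1}=s''_n$ are allowed). Suppose that almost surely every pair $(i,a)\in S\times A$ equals $(s_n,a_n)$ for infinitely many $n$. Let $Q_0\in\mathbb{R}^{S\times A}$ be an initial vector, possibly random and then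 known at time $0$, with $\|Q_0\|\le \frac{C_{\max}}{1-\beta}$ in the maximum norm, and for $(i,a)=(s_n,a_n)$, $j=s'_n$, $d=a'_n$, $k=s''_n$ let $$Q_{n+1}(i,a)=(1-\alpha_n(i,a))Q_n(i,a)+\alpha_n(i,a)\Big(c(i,a,j)+\frac{\beta}{N}\log\sum_{b\in A}e^{NQ_n(j,b)}\Big)+\beta\theta_n\alpha_n(i,a)\Big(c(j,d,k)+\frac{\beta}{N}\log\sum_{e\in A}e^{NQ_n(k,e)}\Big),$$ all other entries being left unchanged. Assume the following. 1. The step sizes $\alpha_n(i,a)\in[0,1]$ may be random, and $\alpha_n$ depends only on the past up to and including $a_n$. Almost surely, for every $(i,a)\in S\times A$, $$\sum_{n:\,(s_n,a_n)=(i,a)}\alpha_n(i,a)=\infty,\qquad \sum_{n:\,(s_n,a_n)=(i,a)}\alpha_n(i,a)^2<\infty .$$ 2. The real numbers $\theta_n$ satisfy $|\theta_n|\le1$, $|\theta_n|$ decreases monotonically to $0$, and $\sum_n\alpha_n(s_n,a_n)|\theta_n|<\infty$ almost surely. Then $U$ has a unique fixed point, and $Q_n$ converges to it almost surely. -/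

import Mathlib

open MeasureTheory Filter Topology

/-- A discounted Markov decision process with finite state space `S` and finite action space `A`:
`p i a j` is the probability of moving to `j` when action `a` is taken in state `i`,
`c i a j` is the reward of that transition, `β ∈ [0,1)` is the discount factor. -/
structure FiniteMDP (S A : Type*) [Fintype S] where
  p : S → A → S → ℝ
  p_nonneg : ∀ i a j, 0 ≤ p i a j
  p_sum : ∀ i a, ∑ j, p i a j = 1
  c : S → A → S → ℝ
  β : ℝ
  β_nonneg : 0 ≤ β
  β_lt_one : β < 1

namespace FiniteMDP

variable {S A : Type*} [Fintype S]

/-- The transition matrix of the Markov chain induced by a deterministic stationary policy `d`. -/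
def transitionMatrix (M : FiniteMDP S A) (d : S → A) : Matrix S S ℝ :=
  Matrix.of fun i j => M.p i (d i) j

/-- The MDP is communicating: for all states `i, j` there is a deterministic stationary policy
under which `j` is accessible from `i`. -/
def Communicating [DecidableEq S] (M : FiniteMDP S A) : Prop :=
  ∀ i j : S, ∃ d : S → A, ∃ n : ℕ, 0 < (M.transitionMatrix d ^ n) i j

/-- The expected one-step reward `c(i,a) = ∑ⱼ p(j|i,a) c(i,a,j)`. -/
def meanReward (M : FiniteMDP S A) (i : S) (a : A) : ℝ :=
  ∑ j, M.p i a j * M.c i a j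

end FiniteMDP

/-- The log-sum-exp function `(1/N) log ∑_b e^{N f(b)}`. -/
noncomputable def smoothMax {A : Type*} [Fintype A] (N : ℝ) (f : A → ℝ) : ℝ :=
  1 / N * Real.log (∑ b, Real.exp (N * f b))

namespace FiniteMDP

variable {S A : Type*} [Fintype S] [Fintype A]

/-- The smooth Bellman operator
`(U Q)(i,a) = c(i,a) + β ∑ⱼ p(j|i,a) (1/N) log ∑_b e^{N Q(j,b)}`. -/
noncomputable def smoothBellman (M : FiniteMDP S A) (N : ℝ) (Q : S → A → ℝ) : S → A → ℝ :=
  fun i a => M.meanReward i a + M.β * ∑ j, M.p i a j * smoothMax N (Q j)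

/-- The smooth two-step Q-learning iterates along one realisation of the samples.
At iteration `n` the sample is
`(s n, a n, s' n, c(s n, a n, s' n), a' n, s'' n, c(s' n, a' n, s'' n))`; only the entry of the
sampled pair `(s n, a n)` is updated, with step size `α n (s n) (a n)`. -/
noncomputable def smoothTwoStepQ [DecidableEq S] [DecidableEq A] (M : FiniteMDP S A) (N : ℝ)
    (θ : ℕ → ℝ) (α : ℕ → S → A → ℝ) (s : ℕ → S) (a : ℕ → A) (s' : ℕ → S) (a' : ℕ → A)
    (s'' : ℕ → S) (Q₀ : S → A → ℝ) : ℕ → S → A → ℝ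
  | 0 => Q₀
  | n + 1 => fun i b =>
      let Q := M.smoothTwoStepQ N θ α s a s' a' s'' Q₀ n
      if s n = i ∧ a n = b then
        (1 - α n i b) * Q i b
          + α n i b * (M.c i b (s' n) + M.β * smoothMax N (Q (s' n)))
          + M.β * θ n * α n i b * (M.c (s' n) (a' n) (s'' n) + M.β * smoothMax N (Q (s'' n)))
      else Q i b

end FiniteMDP

/-- The random samples `(s n, a n, s' n, a' n, s'' n)` are generated by the MDP `M` under some
behaviour policy, with respect to the information available when they are drawn: `ℱ n` is the
information right after the choice of `a n`, and `𝒢 n` the information right after the choice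
of `a' n`. The behaviour policy is any non-anticipating rule for choosing the actions; it may be
randomised and may depend on the past. Given `ℱ n`, the state `s' n` has
law `p(· | s n, a n)`; given `𝒢 n`, the state `s'' n` has law `p(· | s' n, a' n)`.
A single trajectory, with `s (n+1) = s'' n`, is allowed but not required. -/
structure IsSampleProcess {Ω S A : Type*} [Fintype S] {m0 : MeasurableSpace Ω}
    (M : FiniteMDP S A) (P : Measure Ω) (ℱ 𝒢 : Filtration ℕ m0)
    (s : ℕ → Ω → S) (a : ℕ → Ω → A) (s' : ℕ → Ω → S) (a' : ℕ → Ω → A) (s'' : ℕ → Ω → S) :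
    Prop where
  le_mid : ∀ n, ℱ n ≤ 𝒢 n
  mid_le : ∀ n, 𝒢 n ≤ ℱ (n + 1)
  measurable_s : ∀ n, Measurable[ℱ n, ⊤] (s n)
  measurable_a : ∀ n, Measurable[ℱ n, ⊤] (a n)
  measurable_s' : ∀ n, Measurable[𝒢 n, ⊤] (s' n)
  measurable_a' : ∀ n, Measurable[𝒢 n, ⊤] (a' n)
  measurable_s'' : ∀ n, Measurable[ℱ (n + 1), ⊤] (s'' n)
  law_s' : ∀ n j,
    P[Set.indicator {ω | s' n ω = j} (fun _ => (1 : ℝ)) | ℱ n]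
      =ᵐ[P] fun ω => M.p (s n ω) (a n ω) j
  law_s'' : ∀ n j,
    P[Set.indicator {ω | s'' n ω = j} (fun _ => (1 : ℝ)) | 𝒢 n]
      =ᵐ[P] fun ω => M.p (s' n ω) (a' n ω) j

/-! The iteration is asynchronous stochastic approximation for `U`, a max-norm `β`-contraction
because log-sum-exp is 1-Lipschitz. With `w n` equal to the step size at the sampled pair and zero
elsewhere, each entry satisfies `Q (n+1) = (1 - w n) * Q n + w n * U (Q n) + e n`. Once every series
`∑ e n` converges along a realisation, `tendsto_of_async_iteration` gives the limit with no further
probability.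

The error has two parts. The second-step term is absolutely summable: the iterates stay bounded,
since `β (1 + β |θ n|)` is eventually below 1, and `∑ α |θ|` is finite. The sampling error of `s' n`
is a finite sum over states `j` of predictable weights times the centred indicators of `s' n = j`.
The weights are almost surely square-summable, but the bound on the iterates depends on the
realisation, so `ae_exists_tendsto_sum_predictable_mul` truncates them to reach L²-bounded
martingales. -/

/-! ### Deterministic recursions and asynchronous contractions -/

/-- The positive part `v` of `u - b` shrinks by `1 - a n ≤ exp (-a n)` at each step, so `v n * exp
(A n)` does not increase from `n₀` on, while the partial sums `A n` diverge. -/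
theorem eventually_le_add_of_le_convex_combination {u a : ℕ → ℝ} {b : ℝ} {n₀ : ℕ}
    (ha : ∀ n, a n ≤ 1)
    (hsum : Tendsto (fun m => ∑ n ∈ Finset.range m, a n) atTop atTop)
    (hu : ∀ n, n₀ ≤ n → u (n + 1) ≤ (1 - a n) * u n + a n * b) {ε : ℝ} (hε : 0 < ε) :
    ∀ᶠ n in atTop, u n ≤ b + ε := by
  set A : ℕ → ℝ := fun m => ∑ n ∈ Finset.range m, a n with hA
  set v : ℕ → ℝ := fun n => max (u n - b) 0 with hv
  have hv0 : ∀ n, 0 ≤ v n := fun n => le_max_right _ _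
  have hstep : ∀ n, n₀ ≤ n → v (n + 1) ≤ (1 - a n) * v n := by
    intro n hn
    refine max_le ?_ (mul_nonneg (sub_nonneg.2 (ha n)) (hv0 n))
    have h1 : (1 - a n) * (u n - b) ≤ (1 - a n) * v n :=
      mul_le_mul_of_nonneg_left (le_max_left _ _) (sub_nonneg.2 (ha n))
    linarith [hu n hn]
  have hbound : ∀ n, n₀ ≤ n → v n * Real.exp (A n) ≤ v n₀ * Real.exp (A n₀) := by
    intro n hn
    induction n, hn using Nat.le_induction with
    | base => exact le_rfl
    | succ n hn ih =>
      refine le_trans ?_ ih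
      have hAs : A (n + 1) = a n + A n := by
        simp only [hA, Finset.sum_range_succ, add_comm]
      have h2 : 1 - a n ≤ Real.exp (-a n) := by
        linarith [Real.add_one_le_exp (-a n)]
      calc v (n + 1) * Real.exp (A (n + 1))
          ≤ (Real.exp (-a n) * v n) * Real.exp (A (n + 1)) := by
            gcongr
            exact (hstep n hn).trans (mul_le_mul_of_nonneg_right h2 (hv0 n))
        _ = v n * Real.exp (A n) := by
            rw [hAs, Real.exp_add, Real.exp_neg]
            field_simp
  have hlim : Tendsto (fun n => v n₀ * Real.exp (A n₀) * Real.exp (-A n)) atTop (𝓝 0) := by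
    have := (Real.tendsto_exp_neg_atTop_nhds_zero.comp hsum).const_mul
      (v n₀ * Real.exp (A n₀))
    simpa using this
  filter_upwards [hlim.eventually (gt_mem_nhds hε), eventually_ge_atTop n₀] with n h1 h2
  have h3 : v n ≤ v n₀ * Real.exp (A n₀) * Real.exp (-A n) := by
    have := mul_le_mul_of_nonneg_right (hbound n h2) (Real.exp_pos (-A n)).le
    rwa [mul_assoc (v n), ← Real.exp_add, add_neg_cancel, Real.exp_zero, mul_one] at this
  have h4 : u n - b ≤ v n := le_max_left _ _
  linarith

theorem exists_forall_le_of_eventually_le_max {u : ℕ → ℝ} {R : ℝ}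
    (h : ∀ᶠ n in atTop, u (n + 1) ≤ max (u n) R) : ∃ B, ∀ n, u n ≤ B := by
  obtain ⟨n₀, hn₀⟩ := eventually_atTop.1 h
  have h1 : ∀ n, n₀ ≤ n → u n ≤ max (u n₀) R := by
    intro n hn
    induction n, hn using Nat.le_induction with
    | base => exact le_max_left _ _
    | succ n hn ih => exact (hn₀ n hn).trans (max_le ih (le_max_right _ _))
  have h2 : BddAbove (Set.range u) := by
    refine IsBoundedUnder.bddAbove_range ?_
    exact ⟨max (u n₀) R, eventually_map.2 (eventually_atTop.2 ⟨n₀, h1⟩)⟩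
  obtain ⟨B, hB⟩ := h2
  exact ⟨B, fun n => hB ⟨n, rfl⟩⟩

/-- `K / (1 - γ)` is the fixed point of `q ↦ γ * q + K`, so the right side is a convex combination
of `q` and that point, with weight `a * (1 - γ)` on the latter. -/
theorem le_max_of_le_convex_combination {a γ q K u : ℝ} (ha0 : 0 ≤ a) (ha1 : a ≤ 1)
    (hγ0 : 0 ≤ γ) (hγ1 : γ < 1) (hu : u ≤ (1 - a) * q + a * (γ * q + K)) :
    u ≤ max q (K / (1 - γ)) := by
  have hγ : 0 < 1 - γ := sub_pos.2 hγ1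
  have hK : K = (1 - γ) * (K / (1 - γ)) := by field_simp
  set R := K / (1 - γ)
  have h1 : u ≤ (1 - a * (1 - γ)) * q + a * (1 - γ) * R := by rw [hK] at hu; linarith
  have h2 : 0 ≤ a * (1 - γ) := mul_nonneg ha0 hγ.le
  rcases le_total q R with h | h
  · rw [max_eq_right h]
    have h3 : a * (1 - γ) ≤ 1 := mul_le_one₀ ha1 hγ.le (by linarith)
    nlinarith
  · rw [max_eq_left h]; nlinarith

/-- Asynchronous contraction with vanishing perturbation. -/
theorem tendsto_zero_of_async_contraction {ι : Type*} [Fintype ι] {z a : ℕ → ι → ℝ}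
    {δ : ℕ → ℝ} {β : ℝ} (hβ0 : 0 ≤ β) (hβ1 : β < 1)
    (ha0 : ∀ n x, 0 ≤ a n x) (ha1 : ∀ n x, a n x ≤ 1)
    (hsum : ∀ x, Tendsto (fun m => ∑ n ∈ Finset.range m, a n x) atTop atTop)
    (hδ : Tendsto δ atTop (𝓝 0))
    (hz : ∀ n x, |z (n + 1) x| ≤ (1 - a n x) * |z n x| + a n x * (β * ‖z n‖ + δ n)) :
    Tendsto z atTop (𝓝 0) := by
  have hle : ∀ n x, |z n x| ≤ ‖z n‖ := fun n x => norm_le_pi_norm (z n) x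
  obtain ⟨B, hB⟩ : ∃ B, ∀ n, ‖z n‖ ≤ B := by
    refine exists_forall_le_of_eventually_le_max (R := 1 / (1 - β)) ?_
    filter_upwards [hδ.eventually (gt_mem_nhds one_pos)] with n hn
    refine (pi_norm_le_iff_of_nonneg (le_max_of_le_left (norm_nonneg _))).2 fun x => ?_
    refine le_max_of_le_convex_combination (ha0 n x) (ha1 n x) hβ0 hβ1 ((hz n x).trans ?_)
    have h1 := mul_le_mul_of_nonneg_left (hle n x) (sub_nonneg.2 (ha1 n x))
    have h2 := mul_le_mul_of_nonneg_left hn.le (ha0 n x)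
    linarith
  -- The infimum of `E` is the limsup of `‖z n‖`. In `himp` one `η` bounds `δ` and the other is the
  -- slack of the scalar lemma.
  set E : Set ℝ := {D | 0 ≤ D ∧ ∀ᶠ n in atTop, ‖z n‖ ≤ D} with hE
  have hne : E.Nonempty := ⟨B, (norm_nonneg _).trans (hB 0), Eventually.of_forall hB⟩
  have hbd : BddBelow E := ⟨0, fun D hD => hD.1⟩
  have himp : ∀ D ∈ E, ∀ η > 0, β * D + 2 * η ∈ E := by
    rintro D ⟨hD0, hD⟩ η hη
    refine ⟨by positivity, ?_⟩
    obtain ⟨n₀, hn₀⟩ := eventually_atTop.1 (hD.and (hδ.eventually (gt_mem_nhds hη)))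
    have hx : ∀ x, ∀ᶠ n in atTop, |z n x| ≤ β * D + η + η := fun x =>
      eventually_le_add_of_le_convex_combination (n₀ := n₀) (fun n => ha1 n x) (hsum x)
        (fun n hn => (hz n x).trans (by
          have h1 := mul_le_mul_of_nonneg_left (hn₀ n hn).1 hβ0
          have h2 := (hn₀ n hn).2.le
          have := mul_le_mul_of_nonneg_left (add_le_add h1 h2) (ha0 n x)
          linarith)) hη
    filter_upwards [eventually_all.2 hx] with n hn
    refine (pi_norm_le_iff_of_nonneg (by positivity)).2 fun x => ?_
    have := hn x
    rw [Real.norm_eq_abs]; linarith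
  have hL0 : 0 ≤ sInf E := le_csInf hne fun D hD => hD.1
  have hL : sInf E = 0 := by
    by_contra hne0
    have hpos : 0 < sInf E := lt_of_le_of_ne hL0 (Ne.symm hne0)
    -- With `L = sInf E` and `D < L + η`, the new bound is `β D + 2η ≤ β L + 3η < L`, a
    -- contradiction.
    set η := (1 - β) * sInf E / 4 with hη
    have hη0 : 0 < η := by have := sub_pos.2 hβ1; positivity
    obtain ⟨D, hD, hDlt⟩ := exists_lt_of_csInf_lt hne (lt_add_of_pos_right (sInf E) hη0)
    have h1 := csInf_le hbd (himp D hD η hη0)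
    nlinarith
  rw [tendsto_zero_iff_norm_tendsto_zero]
  refine tendsto_order.2 ⟨fun b hb => Eventually.of_forall fun n => hb.trans_le (norm_nonneg _),
    fun b hb => ?_⟩
  obtain ⟨D, hD, hDlt⟩ := exists_lt_of_csInf_lt hne (hL.trans_lt hb)
  exact hD.2.mono fun n hn => hn.trans_lt hDlt

/-- Asynchronous stochastic approximation along one realisation: if the accumulated noise
converges, an asynchronous iteration of a contraction converges to its fixed point. -/
theorem tendsto_of_async_iteration {ι : Type*} [Fintype ι] {q a e : ℕ → ι → ℝ}
    {T : (ι → ℝ) → ι → ℝ} {qs : ι → ℝ} {β : ℝ} (hβ0 : 0 ≤ β) (hβ1 : β < 1)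
    (hT : ∀ f g x, |T f x - T g x| ≤ β * ‖f - g‖) (hqs : T qs = qs)
    (ha0 : ∀ n x, 0 ≤ a n x) (ha1 : ∀ n x, a n x ≤ 1)
    (hsum : ∀ x, Tendsto (fun m => ∑ n ∈ Finset.range m, a n x) atTop atTop)
    (he : ∀ x, ∃ l, Tendsto (fun m => ∑ n ∈ Finset.range m, e n x) atTop (𝓝 l))
    (hq : ∀ n x, q (n + 1) x = (1 - a n x) * q n x + a n x * T (q n) x + e n x) :
    Tendsto q atTop (𝓝 qs) := by
  choose l hl using he
  -- The tail of the noise series. Adding it to `q n - qs` cancels `e n` in the recursion and leaves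
  -- only a perturbation of size `(1 + β) ‖t n‖`, which vanishes.
  set t : ℕ → ι → ℝ := fun m x => l x - ∑ n ∈ Finset.range m, e n x with ht
  have ht0 : Tendsto t atTop (𝓝 0) := by
    refine tendsto_pi_nhds.2 fun x => ?_
    simpa using (hl x).const_sub (l x)
  have htn : Tendsto (fun n => (1 + β) * ‖t n‖) atTop (𝓝 0) := by
    simpa using (tendsto_zero_iff_norm_tendsto_zero.1 ht0).const_mul (1 + β)
  have hz : Tendsto (fun n => q n - qs + t n) atTop (𝓝 0) := by
    refine tendsto_zero_of_async_contraction hβ0 hβ1 ha0 ha1 hsum htn fun n x => ?_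
    have hrec : (q (n + 1) - qs + t (n + 1)) x =
        (1 - a n x) * (q n - qs + t n) x + a n x * (T (q n) x - T qs x + t n x) := by
      simp only [Pi.add_apply, Pi.sub_apply, hq n x, ht, Finset.sum_range_succ, hqs]
      ring
    have h1 : ‖q n - qs‖ ≤ ‖q n - qs + t n‖ + ‖t n‖ := by
      simpa using norm_sub_le (q n - qs + t n) (t n)
    have h2 : |t n x| ≤ ‖t n‖ := norm_le_pi_norm (t n) x
    have h3 : |T (q n) x - T qs x + t n x| ≤ β * ‖q n - qs + t n‖ + (1 + β) * ‖t n‖ := by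
      have := mul_le_mul_of_nonneg_left h1 hβ0
      linarith [abs_add_le (T (q n) x - T qs x) (t n x), hT (q n) qs x]
    rw [hrec]
    refine (abs_add_le _ _).trans ?_
    rw [abs_mul, abs_mul, abs_of_nonneg (ha0 n x), abs_of_nonneg (sub_nonneg.2 (ha1 n x))]
    exact add_le_add le_rfl (mul_le_mul_of_nonneg_left h3 (ha0 n x))
  have h := (hz.sub ht0).add_const qs
  simpa using h

/-- Whenever a term is kept, the full partial sum including it is at most `m`. The induction
therefore also carries that the truncated sum is below the full one. -/
theorem sum_truncated_le {b : ℕ → ℝ} (hb : ∀ n, 0 ≤ b n) {m : ℝ} (hm : 0 ≤ m) (n : ℕ) :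
    ∑ k ∈ Finset.range n, (if ∑ j ∈ Finset.range (k + 1), b j ≤ m then b k else 0) ≤ m := by
  have h : ∑ k ∈ Finset.range n, (if ∑ j ∈ Finset.range (k + 1), b j ≤ m then b k else 0) ≤ m ∧
      ∑ k ∈ Finset.range n, (if ∑ j ∈ Finset.range (k + 1), b j ≤ m then b k else 0)
        ≤ ∑ j ∈ Finset.range n, b j := by
    induction n with
    | zero => simpa using hm
    | succ n ih =>
      rw [Finset.sum_range_succ _ n]
      have hs := Finset.sum_range_succ b n
      have := hb n
      split_ifs with h
      · constructor <;> linarith [ih.1, ih.2]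
      · constructor <;> linarith [ih.1, ih.2]
  exact h.1

/-! ### Almost sure convergence of martingale sums -/

section
variable {Ω : Type*} {m0 : MeasurableSpace Ω} {P : Measure Ω} [IsProbabilityMeasure P]
  {ℱ : Filtration ℕ m0}

/-- Martingale increments are orthogonal, so the second moments of the partial sums are at most `m`.
Then `|x| ≤ 1 + x ^ 2` bounds them in L¹, and Doob's convergence theorem applies. -/
theorem ae_exists_tendsto_sum_of_sum_sq_le {d : ℕ → Ω → ℝ} {C m : ℝ}
    (hd : ∀ n, Measurable[ℱ (n + 1)] (d n)) (hdC : ∀ n ω, |d n ω| ≤ C)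
    (hd0 : ∀ n, P[d n | ℱ n] =ᵐ[P] 0)
    (hdm : ∀ n ω, ∑ k ∈ Finset.range n, d k ω ^ 2 ≤ m) :
    ∀ᵐ ω ∂P, ∃ l, Tendsto (fun n => ∑ k ∈ Finset.range n, d k ω) atTop (𝓝 l) := by
  set X : ℕ → Ω → ℝ := fun n ω => ∑ k ∈ Finset.range n, d k ω with hX
  have hXs : ∀ n, X (n + 1) = X n + d n := fun n => by
    funext ω; simp [hX, Finset.sum_range_succ]
  have hdm0 : ∀ n, Measurable (d n) := fun n => (hd n).mono (ℱ.le _) le_rfl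
  have hdi : ∀ n, Integrable (d n) P := fun n =>
    Integrable.of_bound (hdm0 n).aestronglyMeasurable C (Eventually.of_forall (hdC n))
  have hXmeas : ∀ n, Measurable[ℱ n] (X n) := fun n => by
    refine Finset.measurable_fun_sum _ fun k hk => ?_
    exact (hd k).mono (ℱ.mono (Finset.mem_range.1 hk)) le_rfl
  have hXm0 : ∀ n, Measurable (X n) := fun n => (hXmeas n).mono (ℱ.le _) le_rfl
  have hXb : ∀ n ω, |X n ω| ≤ n * C := fun n ω => by
    refine (Finset.abs_sum_le_sum_abs _ _).trans ?_
    refine (Finset.sum_le_sum fun k _ => hdC k ω).trans ?_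
    simp
  have hXi : ∀ n, Integrable (X n) P := fun n =>
    Integrable.of_bound (hXm0 n).aestronglyMeasurable (n * C) (Eventually.of_forall (hXb n))
  have hmart : Martingale X ℱ P := by
    refine martingale_nat (fun n => (hXmeas n).stronglyMeasurable) hXi fun n => ?_
    rw [hXs]
    filter_upwards [condExp_add (hXi n) (hdi n) (ℱ n), hd0 n] with ω h1 h2
    rw [h1, Pi.add_apply, h2, condExp_of_stronglyMeasurable (ℱ.le n)
      (hXmeas n).stronglyMeasurable (hXi n)]
    simp
  have hXdi : ∀ n, Integrable (X n * d n) P := fun n =>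
    (hdi n).bdd_mul (hXm0 n).aestronglyMeasurable (Eventually.of_forall (hXb n))
  have hcross : ∀ n, ∫ ω, (X n * d n) ω ∂P = 0 := by
    intro n
    rw [← integral_condExp (ℱ.le n)]
    have h := condExp_mul_of_stronglyMeasurable_left (hXmeas n).stronglyMeasurable
      (hXdi n) (hdi n)
    rw [integral_congr_ae (g := 0)]
    · simp
    · filter_upwards [h, hd0 n] with ω h1 h2
      rw [h1]; simp [h2]
  have hd2 : ∀ n, Integrable (fun ω => d n ω ^ 2) P := fun n => by
    refine Integrable.of_bound ((hdm0 n).pow_const 2).aestronglyMeasurable (C ^ 2)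
      (Eventually.of_forall fun ω => ?_)
    rw [Real.norm_eq_abs, abs_pow]
    exact pow_le_pow_left₀ (abs_nonneg _) (hdC n ω) 2
  have hX2 : ∀ n, Integrable (fun ω => X n ω ^ 2) P := fun n => by
    refine Integrable.of_bound ((hXm0 n).pow_const 2).aestronglyMeasurable ((n * C) ^ 2)
      (Eventually.of_forall fun ω => ?_)
    rw [Real.norm_eq_abs, abs_pow]
    exact pow_le_pow_left₀ (abs_nonneg _) (hXb n ω) 2
  have hL2 : ∀ n, ∫ ω, X n ω ^ 2 ∂P = ∫ ω, ∑ k ∈ Finset.range n, d k ω ^ 2 ∂P := by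
    intro n
    induction n with
    | zero => simp [hX]
    | succ n ih =>
      simp only [Finset.sum_range_succ]
      rw [integral_add (integrable_finsetSum _ fun k _ => hd2 k) (hd2 n), ← ih]
      have h1 : (fun ω => X (n + 1) ω ^ 2) =
          fun ω => (X n ω ^ 2 + d n ω ^ 2) + 2 * (X n * d n) ω := by
        funext ω; rw [hXs]; simp only [Pi.add_apply, Pi.mul_apply]; ring
      have h2 : Integrable (fun ω => X n ω ^ 2 + d n ω ^ 2) P := (hX2 n).add (hd2 n)
      rw [h1, integral_add h2 ((hXdi n).const_mul 2), integral_add (hX2 n) (hd2 n),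
        integral_const_mul, hcross n]
      ring
  have hm : ∀ n, ∫ ω, |X n ω| ∂P ≤ 1 + m := by
    intro n
    calc ∫ ω, |X n ω| ∂P ≤ ∫ ω, (1 + X n ω ^ 2) ∂P := by
          refine integral_mono (hXi n).abs ((integrable_const 1).add (hX2 n)) fun ω => ?_
          have := sq_nonneg (|X n ω| - 1)
          have h2 := sq_abs (X n ω)
          have := abs_nonneg (X n ω)
          simp only
          nlinarith
      _ = 1 + ∫ ω, ∑ k ∈ Finset.range n, d k ω ^ 2 ∂P := by
          rw [integral_add (integrable_const 1) (hX2 n), hL2]; simp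
      _ ≤ 1 + ∫ _, m ∂P := by
          gcongr 1 + ?_
          exact integral_mono (integrable_finsetSum _ fun k _ => hd2 k) (integrable_const m)
            (hdm n)
      _ = 1 + m := by simp
  have hbdd : ∀ n, eLpNorm (X n) 1 P ≤ (1 + m).toNNReal := by
    intro n
    rw [eLpNorm_one_eq_lintegral_enorm, ← ofReal_integral_norm_eq_lintegral_enorm (hXi n)]
    exact ENNReal.ofReal_le_ofReal (hm n)
  exact hmart.submartingale.exists_ae_tendsto_of_bdd hbdd

/-- A sum of bounded martingale differences with predictable weights converges almost surely
if the weights are almost surely square-summable. -/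
theorem ae_exists_tendsto_sum_predictable_mul {a ξ : ℕ → Ω → ℝ}
    (ha : ∀ n, Measurable[ℱ n] (a n)) (hξ : ∀ n, Measurable[ℱ (n + 1)] (ξ n))
    (hξ1 : ∀ n ω, |ξ n ω| ≤ 1) (hξ0 : ∀ n, P[ξ n | ℱ n] =ᵐ[P] 0)
    (hsq : ∀ᵐ ω ∂P, Summable fun n => a n ω ^ 2) :
    ∀ᵐ ω ∂P, ∃ l, Tendsto (fun n => ∑ k ∈ Finset.range n, a k ω * ξ k ω) atTop (𝓝 l) := by
  classical
  -- The test includes index `n` itself and is still `ℱ n`-measurable, so the truncated weight stays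
  -- predictable.
  set g : ℕ → ℕ → Ω → ℝ := fun m n ω =>
    if ∑ j ∈ Finset.range (n + 1), a j ω ^ 2 ≤ m then a n ω else 0 with hg
  have hgmeas : ∀ m n, Measurable[ℱ n] (g m n) := by
    intro m n
    refine Measurable.ite ?_ (ha n) measurable_const
    refine measurableSet_le (Finset.measurable_fun_sum _ fun k hk => ?_) measurable_const
    exact ((ha k).mono (ℱ.mono (Nat.lt_succ_iff.1 (Finset.mem_range.1 hk))) le_rfl).pow_const 2
  have hgsq : ∀ m n ω, g m n ω ^ 2 =
      if ∑ j ∈ Finset.range (n + 1), a j ω ^ 2 ≤ m then a n ω ^ 2 else 0 := by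
    intro m n ω
    simp only [hg]; split_ifs <;> simp
  have hgsum : ∀ (m n : ℕ) ω, ∑ k ∈ Finset.range n, g m k ω ^ 2 ≤ m := by
    intro m n ω
    simp only [hgsq]
    exact sum_truncated_le (fun k => sq_nonneg (a k ω)) (Nat.cast_nonneg m) n
  have hgξ : ∀ m n ω, (g m n ω * ξ n ω) ^ 2 ≤ g m n ω ^ 2 := by
    intro m n ω
    rw [mul_pow]
    refine mul_le_of_le_one_right (sq_nonneg _) ?_
    rw [← sq_abs]
    exact pow_le_one₀ (abs_nonneg _) (hξ1 n ω)
  have hdle : ∀ m n ω, |g m n ω * ξ n ω| ≤ m + 1 := by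
    intro m n ω
    have h1 := hgsum m (n + 1) ω
    rw [Finset.sum_range_succ] at h1
    have h2 : 0 ≤ ∑ k ∈ Finset.range n, g m k ω ^ 2 := Finset.sum_nonneg fun _ _ => sq_nonneg _
    refine abs_le_of_sq_le_sq ?_ (by positivity)
    have := hgξ m n ω
    have hm : (0 : ℝ) ≤ m := Nat.cast_nonneg m
    nlinarith
  have hgm0 : ∀ m n, Measurable (g m n) := fun m n => (hgmeas m n).mono (ℱ.le _) le_rfl
  have hξm0 : ∀ n, Measurable (ξ n) := fun n => (hξ n).mono (ℱ.le _) le_rfl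
  have hconv : ∀ m : ℕ, ∀ᵐ ω ∂P, ∃ l,
      Tendsto (fun n => ∑ k ∈ Finset.range n, g m k ω * ξ k ω) atTop (𝓝 l) := by
    intro m
    refine ae_exists_tendsto_sum_of_sum_sq_le (ℱ := ℱ) (C := m + 1) (m := m)
      (fun n => ((hgmeas m n).mono (ℱ.mono n.le_succ) le_rfl).mul (hξ n)) (hdle m)
      (fun n => ?_) fun n ω =>
        (Finset.sum_le_sum fun k _ => hgξ m k ω).trans (hgsum m n ω)
    have hi : Integrable (g m n * ξ n) P :=
      Integrable.of_bound ((hgm0 m n).mul (hξm0 n)).aestronglyMeasurable (m + 1)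
        (Eventually.of_forall (hdle m n))
    have hξi : Integrable (ξ n) P :=
      Integrable.of_bound (hξm0 n).aestronglyMeasurable 1 (Eventually.of_forall (hξ1 n))
    filter_upwards [condExp_mul_of_stronglyMeasurable_left
      (hgmeas m n).stronglyMeasurable hi hξi, hξ0 n] with ω h1 h2
    refine h1.trans ?_
    simp [h2]
  filter_upwards [ae_all_iff.2 hconv, hsq] with ω h1 h2
  -- For this level the truncation never acts along `ω`. Integer levels keep the exceptional null
  -- sets countable in number.
  obtain ⟨m, hm⟩ := exists_nat_ge (∑' n, a n ω ^ 2)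
  obtain ⟨l, hl⟩ := h1 m
  refine ⟨l, hl.congr fun n => Finset.sum_congr rfl fun k _ => ?_⟩
  simp only [hg]
  rw [if_pos]
  exact (h2.sum_le_tsum _ fun _ _ => sq_nonneg _).trans hm
end

/-! ### Log-sum-exp and measurability -/

/-- Log-sum-exp is monotone and commutes with adding constants. Used in both directions, this makes
it 1-Lipschitz. -/
theorem smoothMax_le_add {A : Type*} [Fintype A] [Nonempty A] {N : ℝ} (hN : 0 < N)
    {f g : A → ℝ} {r : ℝ} (h : ∀ b, f b ≤ g b + r) : smoothMax N f ≤ smoothMax N g + r := by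
  have hpos : ∀ h : A → ℝ, 0 < ∑ b, Real.exp (N * h b) := fun h =>
    Finset.sum_pos (fun b _ => Real.exp_pos _) Finset.univ_nonempty
  have h1 : ∑ b, Real.exp (N * f b) ≤ (∑ b, Real.exp (N * g b)) * Real.exp (N * r) := by
    rw [Finset.sum_mul]
    refine Finset.sum_le_sum fun b _ => ?_
    rw [← Real.exp_add, ← mul_add]
    gcongr
    exact h b
  have h2 := Real.log_le_log (hpos f) h1
  rw [Real.log_mul (hpos g).ne' (Real.exp_pos _).ne', Real.log_exp] at h2
  have h3 := mul_le_mul_of_nonneg_left h2 (one_div_pos.2 hN).le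
  have h4 : 1 / N * (N * r) = r := by field_simp
  unfold smoothMax
  rw [mul_add, h4] at h3
  exact h3

theorem abs_smoothMax_sub_le {A : Type*} [Fintype A] [Nonempty A] {N : ℝ} (hN : 0 < N)
    {f g : A → ℝ} {r : ℝ} (h : ∀ b, |f b - g b| ≤ r) :
    |smoothMax N f - smoothMax N g| ≤ r := by
  have h1 := smoothMax_le_add hN fun b => show f b ≤ g b + r by
    linarith [(abs_le.1 (h b)).2]
  have h2 := smoothMax_le_add hN fun b => show g b ≤ f b + r by
    linarith [(abs_le.1 (h b)).1]
  exact abs_le.2 ⟨by linarith, by linarith⟩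

theorem measurable_smoothMax {A : Type*} [Fintype A] (N : ℝ) {Ω : Type*}
    {m : MeasurableSpace Ω} {f : Ω → A → ℝ} (hf : ∀ b, Measurable fun ω => f ω b) :
    Measurable fun ω => smoothMax N (f ω) := by
  unfold smoothMax
  refine (Real.measurable_log.comp ?_).const_mul _
  exact Finset.measurable_fun_sum _ fun b _ => Real.measurable_exp.comp ((hf b).const_mul N)

theorem measurable_comp_of_fintype {Ω T : Type*} [Fintype T] [DecidableEq T]
    {m : MeasurableSpace Ω} {t : Ω → T} (ht : Measurable[m, ⊤] t) {f : Ω → T → ℝ}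
    (hf : ∀ x, Measurable fun ω => f ω x) : Measurable fun ω => f ω (t ω) := by
  have h1 : (fun ω => f ω (t ω)) = fun ω => ∑ x, if t ω = x then f ω x else 0 := by
    funext ω; simp
  rw [h1]
  exact Finset.measurable_fun_sum _ fun x _ =>
    Measurable.ite (ht (t := {x}) trivial) (hf x) measurable_const

/-! ### The smooth Bellman operator and the iterates along one realisation -/

namespace FiniteMDP

variable {S A : Type*} [Fintype S] [Fintype A]

theorem abs_smoothBellman_sub_le [Nonempty A] (M : FiniteMDP S A) {N : ℝ} (hN : 0 < N)
    {Q R : S → A → ℝ} {r : ℝ} (h : ∀ i b, |Q i b - R i b| ≤ r) (i : S) (b : A) :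
    |M.smoothBellman N Q i b - M.smoothBellman N R i b| ≤ M.β * r := by
  have h1 : M.smoothBellman N Q i b - M.smoothBellman N R i b =
      M.β * ∑ j, M.p i b j * (smoothMax N (Q j) - smoothMax N (R j)) := by
    simp only [smoothBellman, mul_sub, Finset.sum_sub_distrib]
    ring
  rw [h1, abs_mul, abs_of_nonneg M.β_nonneg]
  refine mul_le_mul_of_nonneg_left ?_ M.β_nonneg
  calc |∑ j, M.p i b j * (smoothMax N (Q j) - smoothMax N (R j))|
      ≤ ∑ j, |M.p i b j * (smoothMax N (Q j) - smoothMax N (R j))| :=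
        Finset.abs_sum_le_sum_abs _ _
    _ ≤ ∑ j, M.p i b j * r := by
        refine Finset.sum_le_sum fun j _ => ?_
        rw [abs_mul, abs_of_nonneg (M.p_nonneg i b j)]
        exact mul_le_mul_of_nonneg_left (abs_smoothMax_sub_le hN (h j)) (M.p_nonneg i b j)
    _ = r := by rw [← Finset.sum_mul, M.p_sum, one_mul]

theorem exists_unique_fixedPoint_smoothBellman [Nonempty A] (M : FiniteMDP S A) {N : ℝ}
    (hN : 0 < N) : ∃ Qhat : S → A → ℝ, M.smoothBellman N Qhat = Qhat ∧
      ∀ Q : S → A → ℝ, M.smoothBellman N Q = Q → Q = Qhat := by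
  have hU : ContractingWith ⟨M.β, M.β_nonneg⟩ (M.smoothBellman N) := by
    refine ⟨M.β_lt_one, LipschitzWith.of_dist_le_mul fun Q R => ?_⟩
    have h0 : 0 ≤ M.β * dist Q R := mul_nonneg M.β_nonneg dist_nonneg
    refine (dist_pi_le_iff h0).2 fun i => (dist_pi_le_iff h0).2 fun b => ?_
    exact M.abs_smoothBellman_sub_le hN
      (fun i b => (dist_le_pi_dist (Q i) (R i) b).trans (dist_le_pi_dist Q R i)) i b
  exact ⟨_, hU.fixedPoint_isFixedPt, fun Q hQ => hU.fixedPoint_unique hQ⟩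

variable [DecidableEq S] [DecidableEq A]

section
variable (M : FiniteMDP S A) {N : ℝ} {θ : ℕ → ℝ} {α : ℕ → S → A → ℝ} {s : ℕ → S} {a : ℕ → A}
  {s' : ℕ → S} {a' : ℕ → A} {s'' : ℕ → S} {Q₀ : S → A → ℝ}

/-- The update target has size at most `β (1 + β |θ n|) ‖Q n‖` plus a constant, and this factor
tends to `β < 1`. Hence the norm eventually cannot grow beyond a fixed level. -/
theorem exists_abs_smoothTwoStepQ_le [Nonempty A] (hN : 0 < N) (hθ1 : ∀ n, |θ n| ≤ 1)
    (hθ0 : Tendsto (fun n => |θ n|) atTop (𝓝 0))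
    (hα01 : ∀ n i b, 0 ≤ α n i b ∧ α n i b ≤ 1)
    {Cmax : ℝ} (hC : ∀ i a j, |M.c i a j| ≤ Cmax) :
    ∃ B, ∀ n i b j, |M.c i b j +
      M.β * smoothMax N (M.smoothTwoStepQ N θ α s a s' a' s'' Q₀ n j)| ≤ B := by
  set Q := M.smoothTwoStepQ N θ α s a s' a' s'' Q₀ with hQ
  have hβ0 := M.β_nonneg
  have hβ1 := M.β_lt_one
  have hq : ∀ n i b, |Q n i b| ≤ ‖Q n‖ := fun n i b =>
    (norm_le_pi_norm (Q n i) b).trans (norm_le_pi_norm (Q n) i)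
  -- Log-sum-exp need not vanish at zero, where it equals `log |A| / N`.
  set H := Cmax + M.β * |smoothMax N (fun _ : A => 0)| with hH
  have hY : ∀ n i b j, |M.c i b j + M.β * smoothMax N (Q n j)| ≤ H + M.β * ‖Q n‖ := by
    intro n i b j
    have h1 : |smoothMax N (Q n j) - smoothMax N (fun _ : A => 0)| ≤ ‖Q n‖ :=
      abs_smoothMax_sub_le hN fun b => by simpa using hq n j b
    have h2 : |smoothMax N (Q n j)| ≤ ‖Q n‖ + |smoothMax N (fun _ : A => 0)| := by
      have := abs_sub_abs_le_abs_sub (smoothMax N (Q n j)) (smoothMax N (fun _ : A => 0))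
      linarith
    have h3 := abs_add_le (M.c i b j) (M.β * smoothMax N (Q n j))
    rw [abs_mul, abs_of_nonneg hβ0] at h3
    have := mul_le_mul_of_nonneg_left h2 hβ0
    linarith [hC i b j]
  have hlim : Tendsto (fun n => M.β * (1 + M.β * |θ n|)) atTop (𝓝 M.β) := by
    simpa using ((hθ0.const_mul M.β).const_add 1).const_mul M.β
  obtain ⟨B, hB⟩ : ∃ B, ∀ n, ‖Q n‖ ≤ B := by
    -- Any number strictly between `β` and 1 would do. The 2 in `R` comes from `1 + β |θ n| ≤ 2`.
    set γ := (M.β + 1) / 2 with hγ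
    refine exists_forall_le_of_eventually_le_max (R := 2 * |H| / (1 - γ)) ?_
    filter_upwards [hlim.eventually (gt_mem_nhds (show M.β < γ by linarith))] with n hn
    have h0 : 0 ≤ max ‖Q n‖ (2 * |H| / (1 - γ)) := le_max_of_le_left (norm_nonneg _)
    refine (pi_norm_le_iff_of_nonneg h0).2 fun i => (pi_norm_le_iff_of_nonneg h0).2 fun b => ?_
    rw [Real.norm_eq_abs]
    have hrec : Q (n + 1) i b = if s n = i ∧ a n = b then
        (1 - α n i b) * Q n i b
          + α n i b * (M.c i b (s' n) + M.β * smoothMax N (Q n (s' n)))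
          + M.β * θ n * α n i b * (M.c (s' n) (a' n) (s'' n) + M.β * smoothMax N (Q n (s'' n)))
      else Q n i b := rfl
    rw [hrec]
    split_ifs with h
    · obtain ⟨ha0, ha1⟩ := hα01 n i b
      refine le_max_of_le_convex_combination ha0 ha1 (γ := γ) (by linarith) (by linarith) ?_
      set x := α n i b
      have hY1 := hY n i b (s' n)
      have hY2 := hY n (s' n) (a' n) (s'' n)
      set Y1 := M.c i b (s' n) + M.β * smoothMax N (Q n (s' n))
      set Y2 := M.c (s' n) (a' n) (s'' n) + M.β * smoothMax N (Q n (s'' n))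
      have hθn := abs_nonneg (θ n)
      have e1 : |(1 - x) * Q n i b| ≤ (1 - x) * ‖Q n‖ := by
        rw [abs_mul, abs_of_nonneg (sub_nonneg.2 ha1)]
        exact mul_le_mul_of_nonneg_left (hq n i b) (sub_nonneg.2 ha1)
      have e2 : |x * Y1| ≤ x * (H + M.β * ‖Q n‖) := by
        rw [abs_mul, abs_of_nonneg ha0]
        exact mul_le_mul_of_nonneg_left hY1 ha0
      have e3 : |M.β * θ n * x * Y2| ≤ M.β * |θ n| * x * (H + M.β * ‖Q n‖) := by
        rw [abs_mul, abs_mul, abs_mul, abs_of_nonneg ha0, abs_of_nonneg hβ0]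
        exact mul_le_mul_of_nonneg_left hY2 (by positivity)
      have e4 : (1 + M.β * |θ n|) * H ≤ 2 * |H| := by
        have h5 : M.β * |θ n| ≤ 1 := mul_le_one₀ hβ1.le hθn (hθ1 n)
        have h6 : 0 ≤ M.β * |θ n| := by positivity
        calc (1 + M.β * |θ n|) * H ≤ (1 + M.β * |θ n|) * |H| :=
              mul_le_mul_of_nonneg_left (le_abs_self H) (by linarith)
          _ ≤ 2 * |H| := mul_le_mul_of_nonneg_right (by linarith) (abs_nonneg H)
      have e5 := mul_le_mul_of_nonneg_right hn.le (norm_nonneg (Q n))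
      have e6 := mul_le_mul_of_nonneg_left (add_le_add e4 e5) ha0
      have e7 := abs_add_le ((1 - x) * Q n i b + x * Y1) (M.β * θ n * x * Y2)
      have e8 := abs_add_le ((1 - x) * Q n i b) (x * Y1)
      linarith
    · exact (hq n i b).trans (le_max_left _ _)
  exact ⟨H + M.β * B, fun n i b j =>
    (hY n i b j).trans (add_le_add_right (mul_le_mul_of_nonneg_left (hB n) hβ0) H)⟩

theorem tendsto_smoothTwoStepQ_of_noise [Nonempty A] (hN : 0 < N) (hθ1 : ∀ n, |θ n| ≤ 1)
    (hθ0 : Tendsto (fun n => |θ n|) atTop (𝓝 0))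
    (hα01 : ∀ n i b, 0 ≤ α n i b ∧ α n i b ≤ 1)
    {Cmax : ℝ} (hC : ∀ i a j, |M.c i a j| ≤ Cmax)
    (hαsum : ∀ i b, Tendsto
      (fun m => ∑ n ∈ Finset.range m, if s n = i ∧ a n = b then α n i b else 0) atTop atTop)
    (hαθ : Summable (fun n => α n (s n) (a n) * |θ n|))
    (hnoise : ∀ i b j, ∃ l, Tendsto (fun m => ∑ n ∈ Finset.range m,
      (if s n = i ∧ a n = b then α n i b else 0) *
        (M.c i b j + M.β * smoothMax N (M.smoothTwoStepQ N θ α s a s' a' s'' Q₀ n j)) *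
        ((if s' n = j then 1 else 0) - M.p (s n) (a n) j)) atTop (𝓝 l))
    {Qhat : S → A → ℝ} (hQhat : M.smoothBellman N Qhat = Qhat) :
    Tendsto (M.smoothTwoStepQ N θ α s a s' a' s'' Q₀) atTop (𝓝 Qhat) := by
  obtain ⟨B, hB⟩ := M.exists_abs_smoothTwoStepQ_le (s := s) (a := a) (s' := s') (a' := a')
    (s'' := s'') (Q₀ := Q₀) hN hθ1 hθ0 hα01 hC
  set Q := M.smoothTwoStepQ N θ α s a s' a' s'' Q₀ with hQ
  set w : ℕ → S → A → ℝ := fun n i b => if s n = i ∧ a n = b then α n i b else 0 with hw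
  set Y : ℕ → S → A → S → ℝ := fun n i b j => M.c i b j + M.β * smoothMax N (Q n j) with hY
  -- Summing over `j` replaces the random target `Y (s' n)` by predictable coefficients times
  -- centred indicators. Both summands carry `w`, so they vanish off the sampled pair.
  set e : ℕ → S × A → ℝ := fun n x =>
    ∑ j, w n x.1 x.2 * Y n x.1 x.2 j * ((if s' n = j then 1 else 0) - M.p (s n) (a n) j) +
      M.β * θ n * w n x.1 x.2 * Y n (s' n) (a' n) (s'' n) with he
  have hw0 : ∀ n i b, 0 ≤ w n i b := fun n i b => by
    simp only [hw]; split_ifs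
    exacts [(hα01 n i b).1, le_rfl]
  have hw1 : ∀ n i b, w n i b ≤ 1 := fun n i b => by
    simp only [hw]; split_ifs
    exacts [(hα01 n i b).2, zero_le_one]
  have hwα : ∀ n i b, w n i b ≤ α n (s n) (a n) := fun n i b => by
    simp only [hw]; split_ifs with h
    · rw [h.1, h.2]
    · exact (hα01 _ _ _).1
  have hconv : ∀ x : S × A, ∃ l, Tendsto (fun m => ∑ n ∈ Finset.range m, e n x) atTop (𝓝 l) := by
    intro x
    choose l hl using hnoise x.1 x.2
    have hsum : Summable fun n => M.β * θ n * w n x.1 x.2 * Y n (s' n) (a' n) (s'' n) := by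
      refine Summable.of_norm_bounded (hαθ.mul_left (M.β * B)) fun n => ?_
      rw [Real.norm_eq_abs, abs_mul, abs_mul, abs_mul, abs_of_nonneg M.β_nonneg,
        abs_of_nonneg (hw0 n x.1 x.2)]
      have h1 := mul_le_mul (hwα n x.1 x.2) (hB n (s' n) (a' n) (s'' n)) (abs_nonneg _)
        (hα01 _ _ _).1
      have h2 := mul_le_mul_of_nonneg_left h1 (mul_nonneg M.β_nonneg (abs_nonneg (θ n)))
      refine le_trans (le_of_eq ?_) (h2.trans (le_of_eq ?_)) <;> ring
    refine ⟨∑ j, l j + _, ((tendsto_finsetSum Finset.univ fun j _ => hl j).add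
      hsum.hasSum.tendsto_sum_nat).congr fun m => ?_⟩
    simp only [he, Finset.sum_add_distrib]
    rw [Finset.sum_comm]
  have hrec : ∀ n (x : S × A), Q (n + 1) x.1 x.2 = (1 - w n x.1 x.2) * Q n x.1 x.2 +
      w n x.1 x.2 * M.smoothBellman N (Q n) x.1 x.2 + e n x := by
    rintro n ⟨i, b⟩
    have h0 : Q (n + 1) i b = if s n = i ∧ a n = b then
        (1 - α n i b) * Q n i b + α n i b * Y n i b (s' n)
          + M.β * θ n * α n i b * Y n (s' n) (a' n) (s'' n)
      else Q n i b := rfl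
    simp only [h0, he, hw]
    split_ifs with h
    · obtain ⟨rfl, rfl⟩ := h
      -- `U (Q n)` is the mean of the one-step target under `p`, so the centred indicators sum to
      -- the target's deviation from `U (Q n)`.
      have hU : M.smoothBellman N (Q n) (s n) (a n) =
          ∑ j, M.p (s n) (a n) j * Y n (s n) (a n) j := by
        simp only [smoothBellman, meanReward, hY, mul_add, Finset.sum_add_distrib,
          Finset.mul_sum]
        congr 1
        exact Finset.sum_congr rfl fun j _ => by ring
      have hN' : ∑ j, α n (s n) (a n) * Y n (s n) (a n) j *
          ((if s' n = j then 1 else 0) - M.p (s n) (a n) j) =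
          α n (s n) (a n) * (Y n (s n) (a n) (s' n) -
            ∑ j, M.p (s n) (a n) j * Y n (s n) (a n) j) := by
        rw [mul_sub, Finset.mul_sum]
        simp only [mul_sub, Finset.sum_sub_distrib, mul_ite, mul_one, mul_zero,
          Finset.sum_ite_eq, Finset.mem_univ, if_true]
        congr 1
        exact Finset.sum_congr rfl fun j _ => by ring
      rw [hU, hN']
      ring
    · simp
  have hmain : Tendsto (fun n (x : S × A) => Q n x.1 x.2) atTop
      (𝓝 fun x : S × A => Qhat x.1 x.2) :=
    tendsto_of_async_iteration (a := fun n x => w n x.1 x.2) (e := e)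
      (T := fun f x => M.smoothBellman N (fun i b => f (i, b)) x.1 x.2)
      M.β_nonneg M.β_lt_one
      (fun f g x => M.abs_smoothBellman_sub_le hN
        (fun i b => norm_le_pi_norm (f - g) (i, b)) x.1 x.2)
      (funext fun x => congrFun (congrFun hQhat x.1) x.2)
      (fun n x => hw0 n x.1 x.2) (fun n x => hw1 n x.1 x.2) (fun x => hαsum x.1 x.2) hconv hrec
  exact tendsto_pi_nhds.2 fun i => tendsto_pi_nhds.2 fun b =>
    tendsto_pi_nhds.1 hmain (i, b)

end

end FiniteMDP

/-! ### Adaptedness of the iterates and centring of the samples -/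

namespace IsSampleProcess

variable {Ω S A : Type*} [Fintype S]
  {m0 : MeasurableSpace Ω} {M : FiniteMDP S A} {P : Measure Ω} {ℱ 𝒢 : Filtration ℕ m0}
  {s : ℕ → Ω → S} {a : ℕ → Ω → A} {s' : ℕ → Ω → S} {a' : ℕ → Ω → A} {s'' : ℕ → Ω → S}

theorem measurableSet_pair (h : IsSampleProcess M P ℱ 𝒢 s a s' a' s'') (n : ℕ) (i : S) (b : A) :
    MeasurableSet[ℱ n] {ω | s n ω = i ∧ a n ω = b} :=
  MeasurableSet.inter (h.measurable_s n (t := {i}) trivial)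
    (h.measurable_a n (t := {b}) trivial)

theorem measurable_s'_succ (h : IsSampleProcess M P ℱ 𝒢 s a s' a' s'') (n : ℕ) :
    Measurable[ℱ (n + 1), ⊤] (s' n) :=
  (h.measurable_s' n).mono (h.mid_le n) le_rfl

theorem measurable_a'_succ (h : IsSampleProcess M P ℱ 𝒢 s a s' a' s'') (n : ℕ) :
    Measurable[ℱ (n + 1), ⊤] (a' n) :=
  (h.measurable_a' n).mono (h.mid_le n) le_rfl

variable [DecidableEq S] [Fintype A] [DecidableEq A]

theorem measurable_transition (h : IsSampleProcess M P ℱ 𝒢 s a s' a' s'') (n : ℕ) (j : S) :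
    Measurable[ℱ n] fun ω => M.p (s n ω) (a n ω) j := by
  have h1 : (fun ω => M.p (s n ω) (a n ω) j) =
      fun ω => ∑ x : S × A, if s n ω = x.1 ∧ a n ω = x.2 then M.p x.1 x.2 j else 0 := by
    funext ω
    rw [Finset.sum_eq_single (s n ω, a n ω)]
    · simp
    · rintro ⟨i, b⟩ - hne
      refine if_neg fun hx => hne ?_
      simp [hx.1, hx.2]
    · simp
  rw [h1]
  exact Finset.measurable_fun_sum _ fun x _ =>
    Measurable.ite (h.measurableSet_pair n x.1 x.2) measurable_const measurable_const

/-- `Q n` uses only samples of iterations before `n`, all known at `ℱ n`. This makes the noise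
weights predictable. -/
theorem measurable_smoothTwoStepQ (h : IsSampleProcess M P ℱ 𝒢 s a s' a' s'') (N : ℝ)
    {α : ℕ → Ω → S → A → ℝ} (hαmeas : ∀ n i b, Measurable[ℱ n] (fun ω => α n ω i b))
    (θ : ℕ → ℝ) {Q₀ : Ω → S → A → ℝ} (hQ₀meas : ∀ i b, Measurable[ℱ 0] (fun ω => Q₀ ω i b))
    (n : ℕ) (i : S) (b : A) :
    Measurable[ℱ n] fun ω => M.smoothTwoStepQ N θ (fun n => α n ω) (fun n => s n ω)
      (fun n => a n ω) (fun n => s' n ω) (fun n => a' n ω) (fun n => s'' n ω) (Q₀ ω) n i b := by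
  induction n generalizing i b with
  | zero => exact hQ₀meas i b
  | succ n ih =>
    have hle : ℱ n ≤ ℱ (n + 1) := ℱ.mono n.le_succ
    have hα := (hαmeas n i b).mono hle le_rfl
    have hQ := fun i b => (ih i b).mono hle le_rfl
    have hmax := fun j => measurable_smoothMax N (hQ j)
    refine Measurable.ite (hle _ (h.measurableSet_pair n i b)) ?_ (hQ i b)
    refine Measurable.add (Measurable.add ((measurable_const.sub hα).mul (hQ i b))
      (hα.mul ?_)) ((hα.const_mul _).mul ?_)
    · exact measurable_comp_of_fintype (h.measurable_s'_succ n)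
        fun j => measurable_const.add ((hmax j).const_mul M.β)
    · refine Measurable.add ?_
        ((measurable_comp_of_fintype (h.measurable_s'' n) hmax).const_mul M.β)
      refine measurable_comp_of_fintype (h.measurable_s'' n)
        (f := fun ω k => M.c (s' n ω) (a' n ω) k) fun k => ?_
      refine measurable_comp_of_fintype (h.measurable_a'_succ n)
        (f := fun ω d => M.c (s' n ω) d k) fun d => ?_
      exact measurable_comp_of_fintype (h.measurable_s'_succ n)
        (f := fun _ j => M.c j d k) fun j => measurable_const

theorem condExp_indicator_sub_transition [IsProbabilityMeasure P]
    (h : IsSampleProcess M P ℱ 𝒢 s a s' a' s'') (n : ℕ) (j : S) :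
    P[fun ω => (if s' n ω = j then (1 : ℝ) else 0) - M.p (s n ω) (a n ω) j | ℱ n] =ᵐ[P] 0 := by
  have hp : Measurable[ℱ n] fun ω => M.p (s n ω) (a n ω) j := h.measurable_transition n j
  have hset : MeasurableSet {ω | s' n ω = j} :=
    ℱ.le (n + 1) _ (h.measurable_s'_succ n (t := {j}) trivial)
  have hpi : Integrable (fun ω => M.p (s n ω) (a n ω) j) P :=
    Integrable.of_bound (hp.mono (ℱ.le n) le_rfl).aestronglyMeasurable 1
      (Eventually.of_forall fun ω => by
        rw [Real.norm_eq_abs, abs_of_nonneg (M.p_nonneg _ _ _), ← M.p_sum (s n ω) (a n ω)]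
        exact Finset.single_le_sum (fun k _ => M.p_nonneg _ _ k) (Finset.mem_univ j))
  have hii : Integrable ({ω | s' n ω = j}.indicator fun _ => (1 : ℝ)) P :=
    (integrable_const 1).indicator hset
  have heq : (fun ω => (if s' n ω = j then (1 : ℝ) else 0) - M.p (s n ω) (a n ω) j) =
      {ω | s' n ω = j}.indicator (fun _ => (1 : ℝ)) - fun ω => M.p (s n ω) (a n ω) j := by
    funext ω; simp [Set.indicator_apply]
  rw [heq]
  filter_upwards [condExp_sub hii hpi (ℱ n), h.law_s' n j] with ω h1 h2
  rw [h1, Pi.sub_apply, h2, condExp_of_stronglyMeasurable (ℱ.le n) hp.stronglyMeasurable hpi]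
  simp

end IsSampleProcess

/-! ### Almost sure convergence -/

theorem theorem3 {S A : Type*} [Fintype S] [DecidableEq S] [Fintype A] [DecidableEq A]
    (M : FiniteMDP S A) (hcomm : M.Communicating)
    (Cmax : ℝ) (hC : ∀ i a j, |M.c i a j| ≤ Cmax)
    (N : ℝ) (hN : 0 < N)
    -- the random samples; the behaviour policy visits every state-action pair infinitely often
    {Ω : Type*} [m0 : MeasurableSpace Ω] (P : Measure Ω) [IsProbabilityMeasure P]
    (ℱ 𝒢 : Filtration ℕ m0)
    (s : ℕ → Ω → S) (a : ℕ → Ω → A) (s' : ℕ → Ω → S) (a' : ℕ → Ω → A) (s'' : ℕ → Ω → S)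
    (hsample : IsSampleProcess M P ℱ 𝒢 s a s' a' s'')
    (hvisit : ∀ᵐ ω ∂P, ∀ i b, ∃ᶠ n in atTop, s n ω = i ∧ a n ω = b)
    -- the step sizes; the sums run over the iterations at which the pair is updated
    (α : ℕ → Ω → S → A → ℝ) (hαmeas : ∀ n i b, Measurable[ℱ n] (fun ω => α n ω i b))
    (hα01 : ∀ n ω i b, 0 ≤ α n ω i b ∧ α n ω i b ≤ 1)
    (hαsum : ∀ᵐ ω ∂P, ∀ i b,
      Tendsto (fun m => ∑ n ∈ Finset.range m, if s n ω = i ∧ a n ω = b then α n ω i b else 0)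
        atTop atTop)
    (hαsq : ∀ᵐ ω ∂P, ∀ i b,
      Summable (fun n => if s n ω = i ∧ a n ω = b then (α n ω i b) ^ 2 else 0))
    -- the weights of the second step
    (θ : ℕ → ℝ) (hθ1 : ∀ n, |θ n| ≤ 1) (hθanti : Antitone (fun n => |θ n|))
    (hθ0 : Tendsto (fun n => |θ n|) atTop (𝓝 0))
    (hαθ : ∀ᵐ ω ∂P, Summable (fun n => α n ω (s n ω) (a n ω) * |θ n|))
    -- the initial vector; the norm is the maximum norm
    (Q₀ : Ω → S → A → ℝ) (hQ₀meas : ∀ i b, Measurable[ℱ 0] (fun ω => Q₀ ω i b))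
    (hQ₀ : ∀ ω, ‖Q₀ ω‖ ≤ Cmax / (1 - M.β)) :
    ∃ Qhat : S → A → ℝ,
      M.smoothBellman N Qhat = Qhat ∧
      (∀ Q : S → A → ℝ, M.smoothBellman N Q = Q → Q = Qhat) ∧
      ∀ᵐ ω ∂P, Tendsto
        (fun n => M.smoothTwoStepQ N θ (fun n => α n ω) (fun n => s n ω) (fun n => a n ω)
          (fun n => s' n ω) (fun n => a' n ω) (fun n => s'' n ω) (Q₀ ω) n)
        atTop (𝓝 Qhat) := by
  obtain ⟨ω₀⟩ : Nonempty Ω := nonempty_of_isProbabilityMeasure P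
  have : Nonempty A := ⟨a 0 ω₀⟩
  obtain ⟨Qhat, hfix, huniq⟩ := M.exists_unique_fixedPoint_smoothBellman hN
  refine ⟨Qhat, hfix, huniq, ?_⟩
  set Q : Ω → ℕ → S → A → ℝ := fun ω =>
    M.smoothTwoStepQ N θ (fun n => α n ω) (fun n => s n ω) (fun n => a n ω)
      (fun n => s' n ω) (fun n => a' n ω) (fun n => s'' n ω) (Q₀ ω) with hQ
  have hnoise : ∀ i b j, ∀ᵐ ω ∂P, ∃ l, Tendsto (fun m => ∑ n ∈ Finset.range m,
      (if s n ω = i ∧ a n ω = b then α n ω i b else 0) *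
        (M.c i b j + M.β * smoothMax N (Q ω n j)) *
        ((if s' n ω = j then 1 else 0) - M.p (s n ω) (a n ω) j)) atTop (𝓝 l) := by
    intro i b j
    refine ae_exists_tendsto_sum_predictable_mul (ℱ := ℱ)
      (a := fun n ω => (if s n ω = i ∧ a n ω = b then α n ω i b else 0) *
        (M.c i b j + M.β * smoothMax N (Q ω n j)))
      (ξ := fun n ω => (if s' n ω = j then 1 else 0) - M.p (s n ω) (a n ω) j)
      (fun n => ?_) (fun n => ?_) (fun n ω => ?_)
      (fun n => hsample.condExp_indicator_sub_transition n j) ?_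
    · refine Measurable.mul
        (Measurable.ite (hsample.measurableSet_pair n i b) (hαmeas n i b) measurable_const)
        (measurable_const.add (Measurable.const_mul ?_ M.β))
      exact measurable_smoothMax N fun d =>
        hsample.measurable_smoothTwoStepQ N hαmeas θ hQ₀meas n j d
    · exact (Measurable.ite (hsample.measurable_s'_succ n (t := {j}) trivial)
        measurable_const measurable_const).sub
        ((hsample.measurable_transition n j).mono (ℱ.mono n.le_succ) le_rfl)
    · have h0 := M.p_nonneg (s n ω) (a n ω) j
      have h1 : M.p (s n ω) (a n ω) j ≤ 1 := by
        rw [← M.p_sum (s n ω) (a n ω)]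
        exact Finset.single_le_sum (fun k _ => M.p_nonneg _ _ k) (Finset.mem_univ j)
      rw [abs_le]
      split_ifs <;> constructor <;> linarith
    -- The bound `B` depends on `ω`, which is harmless because only almost sure square-summability
    -- is required.
    · filter_upwards [hαsq] with ω hω
      obtain ⟨B, hB⟩ := M.exists_abs_smoothTwoStepQ_le (s := fun n => s n ω)
        (a := fun n => a n ω) (s' := fun n => s' n ω) (a' := fun n => a' n ω)
        (s'' := fun n => s'' n ω) (Q₀ := Q₀ ω) hN hθ1 hθ0 (fun n => hα01 n ω) hC
      refine Summable.of_nonneg_of_le (fun n => sq_nonneg _) (fun n => ?_)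
        ((hω i b).mul_right (B ^ 2))
      rw [mul_pow, ite_pow, zero_pow two_ne_zero]
      refine mul_le_mul_of_nonneg_left ?_ (by split_ifs <;> positivity)
      rw [← sq_abs]
      exact pow_le_pow_left₀ (abs_nonneg _) (hB n i b j) 2
  have hnoise' := ae_all_iff.2 fun i => ae_all_iff.2 fun b => ae_all_iff.2 (hnoise i b)
  filter_upwards [hnoise', hαsum, hαθ] with ω h1 h2 h3
  exact M.tendsto_smoothTwoStepQ_of_noise hN hθ1 hθ0 (fun n => hα01 n ω) hC h2 h3 h1 hfix
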